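/- Conventions. $\mathcal H$ is a separable complex Hilbert space, $(\Omega_1,\Sigma_1)$ and $(\Omega_2,\Sigma_2)$ are arbitrary measurable spaces, and a POVM $\mathsf M:\Sigma\to\mathcal L(\mathcal H)$ is a weakly $\sigma$-additive map on a $\sigma$-algebra $\Sigma$ with values in the positive bounded operators and $\mathsf M(\Omega)=I_{\mathcal H}$. A Markov kernel is a map $\beta:\Sigma_2\times\Omega_1\to[0,1]$ such that $\beta(\cdot,x)$ is a probability measure for every $x\in\Omega_1$ and $\beta(Y,\cdot)$ is measurable for every $Y\in\Sigma_2$. For a POVM $\mathsf M_1$ on $\Sigma_1$, the post-processed POVM $\mathsf M_1^\beta$ on $\Sigma_2$ is given by $$\mathsf M_1^\beta(Y)=\int_{\Omega_1}\beta(Y,x)\,\mathrm d\mathsf M_1(x)\quad\text{(weakly)},\qquad Y\in\Sigma_2 .$$ A POVM $\mathsf M:\Sigma\to\mathcal L(\mathcal H)$ is of rank 1 if there are a $\sigma$-finite measure $\mu$ on $\Sigma$ with $\mathsf M\ll\mu$, a direct integral $\mathcal H_\oplus=\int_\Omega^\oplus\mathcal H(x)\,\mathrm d\mu(x)$ of separable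 Hilbert spaces with $\dim\mathcal H(x)=1$ for $\mu$-almost all $x\in\Omega$, and an isometry $J:\mathcal H\to\mathcal H_\oplus$ such that $\mathsf M(X)=J^*\mathsf P_\oplus(X)J$ for all $X\in\Sigma$, where $\mathsf P_\oplus(X)$ is multiplication by the characteristic function of $X$, and such that the vectors $\mathsf P_\oplus(X)J\varphi$ ($X\in\Sigma$, $\varphi\in\mathcal H$) span a dense subspace of $\mathcal H_\oplus$. Theorem. Let $\mathsf M_1:\Sigma_1\to\mathcal L(\mathcal H)$ be a POVM and $\beta:\Sigma_2\times\Omega_1\to[0,1]$ a Markov kernel. If $\mathsf M_1^\beta$ is of rank 1, then $\mathsf M_1$ is of rank 1. -/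

import Mathlib

open MeasureTheory ProbabilityTheory
open scoped ENNReal

noncomputable section

/-- A normalized positive-operator-valued measure (an observable) on the measurable space `Ω`,
with values in the bounded operators of `H`. As for Mathlib's `VectorMeasure`, it is stored as a
function of all subsets of `Ω` which vanishes on the non-measurable ones. -/
structure POVM (Ω : Type*) [MeasurableSpace Ω] (H : Type*) [NormedAddCommGroup H]
    [InnerProductSpace ℂ H] where
  /-- the operator assigned to a set -/
  op : Set Ω → (H →L[ℂ] H)
  not_measurable : ∀ X : Set Ω, ¬ MeasurableSet X → op X = 0
  pos : ∀ X : Set Ω, MeasurableSet X → (op X).IsPositive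
  univ : op Set.univ = ContinuousLinearMap.id ℂ H
  weak_iUnion : ∀ X : ℕ → Set Ω, (∀ j, MeasurableSet (X j)) →
    Pairwise (Function.onFun Disjoint X) → ∀ φ ψ : H,
      HasSum (fun j => inner ℂ φ (op (X j) ψ)) (inner ℂ φ (op (⋃ j, X j) ψ))

namespace POVM

variable {Ω : Type*} [MeasurableSpace Ω] {H : Type*} [NormedAddCommGroup H]
  [InnerProductSpace ℂ H]

theorem empty (M : POVM Ω H) : M.op ∅ = 0 := by
  ext ψ
  have h := M.weak_iUnion (fun _ => ∅) (fun _ => MeasurableSet.empty)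
    (fun i j _ => disjoint_bot_left) (M.op ∅ ψ) ψ
  have h0 := (summable_const_iff (inner ℂ (M.op ∅ ψ) (M.op ∅ ψ))).1 h.summable
  simpa using h0

/-- The outcome measure `X ↦ ⟨φ, M(X) φ⟩` (a probability measure if `φ` is a unit vector). -/
def outcome (M : POVM Ω H) (φ : H) : Measure Ω :=
  Measure.ofMeasurable (fun X _ => ENNReal.ofReal (inner ℂ φ (M.op X φ)).re)
    (by simp [M.empty]) (by
      intro X hX hd
      have h := Complex.hasSum_re (M.weak_iUnion X hX hd φ φ)
      have hpos : ∀ j, 0 ≤ (inner ℂ φ (M.op (X j) φ)).re := fun j =>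
        (M.pos (X j) (hX j)).re_inner_nonneg_right φ
      rw [← h.tsum_eq, ENNReal.ofReal_tsum_of_nonneg hpos h.summable])

theorem outcome_apply (M : POVM Ω H) (φ : H) {X : Set Ω} (hX : MeasurableSet X) :
    M.outcome φ X = ENNReal.ofReal (inner ℂ φ (M.op X φ)).re :=
  Measure.ofMeasurable_apply X hX

/-- Absolute continuity `M ≪ μ`. -/
def AbsCont (M : POVM Ω H) (μ : Measure Ω) : Prop :=
  ∀ X : Set Ω, MeasurableSet X → μ X = 0 → M.op X = 0

/-- `M₂ = M₁^β`: the observable `M₂` is the post-processing of `M₁` by the kernel `β`, i.e.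
`M₂(Y) = ∫ β(Y, x) dM₁(x)` weakly, for all measurable `Y`. -/
def IsPostProcessing {Ω₁ Ω₂ : Type*} [MeasurableSpace Ω₁] [MeasurableSpace Ω₂]
    (M₁ : POVM Ω₁ H) (β : Kernel Ω₁ Ω₂) (M₂ : POVM Ω₂ H) : Prop :=
  ∀ Y : Set Ω₂, MeasurableSet Y → ∀ φ : H,
    inner ℂ φ (M₂.op Y φ) = ((∫ x, (β x).real Y ∂(M₁.outcome φ) : ℝ) : ℂ)

end POVM

/-- The sequence space `ℓ²(ℕ, ℂ)`, in which all fibres of direct integrals are realized. -/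
abbrev EllTwo : Type := lp (fun _ : ℕ => ℂ) 2

/-- The standard Hilbert space of dimension `n ∈ {0, 1, …, ∞}`: the sequences in `ℓ²(ℕ, ℂ)` that
are supported on the indices `k < n`. -/
def stdFibre (n : ℕ∞) : Submodule ℂ EllTwo where
  carrier := {v | ∀ k : ℕ, n ≤ (k : ℕ∞) → v k = 0}
  zero_mem' := by intro k _; simp
  add_mem' := by
    intro v w hv hw k hk
    simp [hv k hk, hw k hk]
  smul_mem' := by
    intro c v hv k hk
    simp [hv k hk]

section DirectIntegral

variable {Ω : Type*} [MeasurableSpace Ω]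

/-- The direct integral `∫^⊕ H(x) dμ(x)` of the separable Hilbert spaces `H(x)` of dimension
`m(x)`, realized with the standard fibres: (classes of) square-integrable functions `f` with values
in `ℓ²(ℕ, ℂ)` such that `f(x)` lies in `H(x)` for almost all `x`. -/
def directIntegral (μ : Measure Ω) (m : Ω → ℕ∞) : Submodule ℂ (Lp EllTwo 2 μ) where
  carrier := {f | ∀ᵐ x ∂μ, f x ∈ stdFibre (m x)}
  zero_mem' := by
    filter_upwards [Lp.coeFn_zero EllTwo 2 μ] with x hx
    rw [hx]
    exact (stdFibre (m x)).zero_mem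
  add_mem' := by
    intro f g hf hg
    change ∀ᵐ x ∂μ, (f + g : Lp EllTwo 2 μ) x ∈ stdFibre (m x)
    filter_upwards [Lp.coeFn_add f g, hf, hg] with x hx hfx hgx
    rw [hx]
    exact (stdFibre (m x)).add_mem hfx hgx
  smul_mem' := by
    intro c f hf
    change ∀ᵐ x ∂μ, (c • f : Lp EllTwo 2 μ) x ∈ stdFibre (m x)
    filter_upwards [Lp.coeFn_smul c f, hf] with x hx hfx
    rw [hx]
    exact (stdFibre (m x)).smul_mem c hfx

/-- Multiplication by the characteristic function of `X`, on square-integrable functions. -/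
def indicatorMul (μ : Measure Ω) (X : Set Ω) (hX : MeasurableSet X) :
    Lp EllTwo 2 μ →ₗ[ℂ] Lp EllTwo 2 μ where
  toFun f := ((Lp.memLp f).indicator hX).toLp (X.indicator f)
  map_add' f g := by
    apply Lp.ext
    filter_upwards [Lp.coeFn_add f g, ((Lp.memLp f).indicator hX).coeFn_toLp,
      ((Lp.memLp g).indicator hX).coeFn_toLp, ((Lp.memLp (f + g)).indicator hX).coeFn_toLp,
      Lp.coeFn_add (((Lp.memLp f).indicator hX).toLp (X.indicator f))
        (((Lp.memLp g).indicator hX).toLp (X.indicator g))] with x h1 h2 h3 h4 h5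
    rw [h4, h5, Pi.add_apply, h2, h3]
    by_cases h : x ∈ X
    · simpa [h] using h1
    · simp [h]
  map_smul' c f := by
    apply Lp.ext
    filter_upwards [Lp.coeFn_smul c f, ((Lp.memLp f).indicator hX).coeFn_toLp,
      ((Lp.memLp (c • f)).indicator hX).coeFn_toLp,
      Lp.coeFn_smul c (((Lp.memLp f).indicator hX).toLp (X.indicator f))] with x h1 h2 h3 h4
    rw [h3, RingHom.id_apply, h4, Pi.smul_apply, h2]
    by_cases h : x ∈ X
    · simpa [h] using h1
    · simp [h]

theorem indicatorMul_mem {μ : Measure Ω} {m : Ω → ℕ∞} {X : Set Ω} (hX : MeasurableSet X)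
    {f : Lp EllTwo 2 μ} (hf : f ∈ directIntegral μ m) :
    indicatorMul μ X hX f ∈ directIntegral μ m := by
  have hf' : ∀ᵐ x ∂μ, f x ∈ stdFibre (m x) := hf
  change ∀ᵐ x ∂μ, (((Lp.memLp f).indicator hX).toLp (X.indicator f)) x ∈ stdFibre (m x)
  filter_upwards [((Lp.memLp f).indicator hX).coeFn_toLp, hf'] with x hx hfx
  rw [hx]
  by_cases h : x ∈ X
  · simpa [h] using hfx
  · simp [h]

/-- The value at a measurable set `X` of the canonical spectral measure of a direct integral: the
operator of multiplication by the characteristic function of `X`. -/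
def canonicalProj (μ : Measure Ω) (m : Ω → ℕ∞) (X : Set Ω) (hX : MeasurableSet X) :
    directIntegral μ m →ₗ[ℂ] directIntegral μ m :=
  (indicatorMul μ X hX).restrict fun _ hf => indicatorMul_mem hX hf

end DirectIntegral

namespace POVM

variable {Ω : Type*} [MeasurableSpace Ω] {H : Type*} [NormedAddCommGroup H]
  [InnerProductSpace ℂ H]

/-- A minimal diagonal Naimark dilation of `M` over `μ`: a direct integral `∫^⊕ H(x) dμ(x)` with
`dim H(x) = m(x)` and an isometry `J` of `H` into it such that `M(X) = J* P(X) J` for the canonical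
spectral measure `P`, and such that the vectors `P(X) J φ` span a dense subspace. -/
structure MinimalDilation (M : POVM Ω H) (μ : Measure Ω) where
  /-- the dimension function `x ↦ dim H(x)` -/
  m : Ω → ℕ∞
  measurable_m : Measurable m
  /-- the isometry into the direct integral -/
  J : H →ₗᵢ[ℂ] directIntegral μ m
  dilation : ∀ (X : Set Ω) (hX : MeasurableSet X) (φ ψ : H),
    inner ℂ φ (M.op X ψ) = inner ℂ (J φ) (canonicalProj μ m X hX (J ψ))
  minimal : Dense (Submodule.span ℂ
    {f : directIntegral μ m | ∃ (X : Set Ω) (hX : MeasurableSet X) (φ : H),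
      f = canonicalProj μ m X hX (J φ)} : Set (directIntegral μ m))

/-- `M` is of rank 1: in its minimal diagonal Naimark dilation (over some σ-finite `μ` with
`M ≪ μ`), almost all fibres are one-dimensional. The condition forces `μ` to be equivalent to
`M`. -/
def IsRankOne (M : POVM Ω H) : Prop :=
  ∃ μ : Measure Ω, SigmaFinite μ ∧ M.AbsCont μ ∧
    ∃ D : MinimalDilation M μ, ∀ᵐ x ∂μ, D.m x = 1

end POVM

end

noncomputable section

namespace POVM

variable {Ω : Type*} [MeasurableSpace Ω] {H : Type*} [NormedAddCommGroup H]
  [InnerProductSpace ℂ H]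

/-! Fix a finite measure `μ₁` equivalent to `M₁`. The complex measures ⟨φ, M₁(·)ψ⟩ have densities
`formDens` with respect to `μ₁`. For almost every x they behave like a positive sesquilinear form,
and rank 1 means that this form has rank one.

Let v_φ(y) be the scalar representing φ in the one-dimensional fibre of M₂, so that |v_φ|² is the
density of its outcome measure. On Ω₁ × Ω₂ take the joint measure `μ₁ ⊗ₘ β`. Evaluate the form at x
on v_ψ(y)φ − v_φ(y)ψ, a vector that v(y) annihilates. The value is nonnegative, and post-processing
turns its joint integral into ∫ |v_ψ v_φ − v_φ v_ψ|² dμ₂ = 0, so it vanishes almost everywhere.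
Equality in Cauchy–Schwarz gives |v_ψ(y)|² `dens` φ (x) = |v_φ(y)|² `dens` ψ (x)
(`norm_sq_mul_dens_comm`). By polarization the form at x is then c(x,y) times the rank one form of
v(y) (`exists_formDens_eq`).

Hence the 2 × 2 minor relations hold for the form at almost every x. A nonzero diagonal entry yields
a scalar factor w of the form (`exists_scalar_factorization`), and w defines the isometry of a
minimal dilation with fibres of dimension one (`isRankOne_of_scalar`). All linearity relations hold
only almost everywhere for fixed vectors, which suffices because J takes values in an L² space. -/

/-! ### Outcome measures and densities of the sesquilinear form -/

theorem outcome_univ (M : POVM Ω H) (φ : H) :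
    M.outcome φ Set.univ = ENNReal.ofReal (‖φ‖ ^ 2) := by
  rw [M.outcome_apply φ MeasurableSet.univ, M.univ]
  congr 1
  simpa using inner_self_eq_norm_sq (𝕜 := ℂ) φ

instance isFiniteMeasure_outcome (M : POVM Ω H) (φ : H) : IsFiniteMeasure (M.outcome φ) :=
  ⟨by rw [outcome_univ]; exact ENNReal.ofReal_lt_top⟩

theorem outcome_real_apply (M : POVM Ω H) (φ : H) {X : Set Ω} (hX : MeasurableSet X) :
    (M.outcome φ).real X = (inner ℂ φ (M.op X φ)).re := by
  rw [Measure.real, M.outcome_apply φ hX, ENNReal.toReal_ofReal]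
  exact (M.pos X hX).re_inner_nonneg_right φ

theorem inner_op_comm (M : POVM Ω H) {X : Set Ω} (hX : MeasurableSet X) (φ ψ : H) :
    inner ℂ ψ (M.op X φ) = star (inner ℂ φ (M.op X ψ)) := by
  have h := (M.pos X hX).isSymmetric ψ φ
  change inner ℂ (M.op X ψ) φ = inner ℂ ψ (M.op X φ) at h
  rw [← h]
  exact (inner_conj_symm _ _).symm

theorem op_eq_zero_of_outcome (M : POVM Ω H) {u : ℕ → H} (hu : DenseRange u) {X : Set Ω}
    (hX : MeasurableSet X) (h : ∀ n, M.outcome (u n) X = 0) : M.op X = 0 := by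
  have hre : (fun φ : H => (inner ℂ φ (M.op X φ)).re) = fun _ => 0 := by
    refine hu.equalizer (by fun_prop) (by fun_prop) ?_
    ext n
    simp only [Function.comp_apply]
    rw [← M.outcome_real_apply _ hX, Measure.real, h n, ENNReal.toReal_zero]
  have him : ∀ φ : H, (inner ℂ φ (M.op X φ)).im = 0 := by
    intro φ
    have := congrArg Complex.im (M.inner_op_comm hX φ φ)
    simp only [RCLike.star_def, Complex.conj_im] at this
    linarith
  have hz : ((M.op X : H →L[ℂ] H) : H →ₗ[ℂ] H) = 0 := by
    rw [← inner_map_self_eq_zero]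
    intro φ
    rw [ContinuousLinearMap.coe_coe, ← inner_conj_symm,
      Complex.ext (congrFun hre φ) (him φ) (w := 0)]
    simp
  ext φ
  exact congrArg (fun T : H →ₗ[ℂ] H => T φ) hz

theorem AbsCont.outcome {M : POVM Ω H} {μ : Measure Ω} (h : M.AbsCont μ) (φ : H) :
    M.outcome φ ≪ μ := by
  refine Measure.AbsolutelyContinuous.mk fun X hX h0 => ?_
  rw [M.outcome_apply φ hX, h X hX h0]
  simp

/-- The density of the outcome measure of `φ` with respect to `μ`. -/
def dens (M : POVM Ω H) (μ : Measure Ω) (φ : H) (x : Ω) : ℝ :=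
  ((M.outcome φ).rnDeriv μ x).toReal

/-- The density of the complex measure `X ↦ ⟨φ, M(X) ψ⟩` with respect to `μ`. -/
def formDens (M : POVM Ω H) (μ : Measure Ω) (φ ψ : H) (x : Ω) : ℂ :=
  -- Polarization. The inner product is conjugate linear on the left, so `φ + Complex.I • ψ`
  -- contributes −2 Im; hence the sign in the second component.
  ⟨(M.dens μ (φ + ψ) x - M.dens μ φ x - M.dens μ ψ x) / 2,
    (M.dens μ φ x + M.dens μ ψ x - M.dens μ (φ + Complex.I • ψ) x) / 2⟩

section

variable (M : POVM Ω H) (μ : Measure Ω)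

@[fun_prop]
theorem measurable_dens (φ : H) : Measurable (M.dens μ φ) :=
  (Measure.measurable_rnDeriv _ _).ennreal_toReal

theorem dens_nonneg (φ : H) (x : Ω) : 0 ≤ M.dens μ φ x := ENNReal.toReal_nonneg

theorem integrable_dens (φ : H) : Integrable (M.dens μ φ) μ := Measure.integrable_toReal_rnDeriv

theorem setIntegral_dens [SigmaFinite μ] (h : M.AbsCont μ) (φ : H) {X : Set Ω}
    (hX : MeasurableSet X) :
    ∫ x in X, M.dens μ φ x ∂μ = (inner ℂ φ (M.op X φ)).re := by
  rw [← M.outcome_real_apply φ hX]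
  exact Measure.setIntegral_toReal_rnDeriv (h.outcome φ) X

@[fun_prop]
theorem measurable_formDens (φ ψ : H) : Measurable (M.formDens μ φ ψ) := by
  have : M.formDens μ φ ψ = fun x =>
      (((M.dens μ (φ + ψ) x - M.dens μ φ x - M.dens μ ψ x) / 2 : ℝ) : ℂ) +
      (((M.dens μ φ x + M.dens μ ψ x - M.dens μ (φ + Complex.I • ψ) x) / 2 : ℝ) : ℂ)
        * Complex.I := by
    ext x
    exact (Complex.re_add_im (M.formDens μ φ ψ x)).symm
  rw [this]
  fun_prop

theorem integrable_formDens_re (φ ψ : H) : Integrable (fun x => (M.formDens μ φ ψ x).re) μ :=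
  (((M.integrable_dens μ _).sub (M.integrable_dens μ _)).sub (M.integrable_dens μ _)).div_const 2

theorem integrable_formDens_im (φ ψ : H) : Integrable (fun x => (M.formDens μ φ ψ x).im) μ :=
  (((M.integrable_dens μ _).add (M.integrable_dens μ _)).sub (M.integrable_dens μ _)).div_const 2

theorem integrable_formDens (φ ψ : H) : Integrable (M.formDens μ φ ψ) μ :=
  Integrable.re_im_iff.1 ⟨M.integrable_formDens_re μ φ ψ, M.integrable_formDens_im μ φ ψ⟩

theorem setIntegral_formDens [SigmaFinite μ] (h : M.AbsCont μ) (φ ψ : H) {X : Set Ω}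
    (hX : MeasurableSet X) :
    ∫ x in X, M.formDens μ φ ψ x ∂μ = inner ℂ φ (M.op X ψ) := by
  have i1 := fun ξ : H => (M.integrable_dens μ ξ).integrableOn (s := X)
  have hc := M.inner_op_comm hX φ ψ
  rw [← integral_re_add_im (M.integrable_formDens μ φ ψ).integrableOn]
  have hre : ∫ x in X, RCLike.re (M.formDens μ φ ψ x) ∂μ = (inner ℂ φ (M.op X ψ)).re := by
    change ∫ x in X, (M.dens μ (φ + ψ) x - M.dens μ φ x - M.dens μ ψ x) / 2 ∂μ = _
    rw [integral_div, integral_sub (f := fun x => M.dens μ (φ + ψ) x - M.dens μ φ x)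
      ((i1 _).sub (i1 _)) (i1 _), integral_sub (i1 _) (i1 _),
      M.setIntegral_dens μ h _ hX, M.setIntegral_dens μ h _ hX, M.setIntegral_dens μ h _ hX]
    simp only [map_add, inner_add_left, inner_add_right, Complex.add_re, hc, RCLike.star_def,
      Complex.conj_re]
    ring
  have him : ∫ x in X, RCLike.im (M.formDens μ φ ψ x) ∂μ = (inner ℂ φ (M.op X ψ)).im := by
    change ∫ x in X, (M.dens μ φ x + M.dens μ ψ x - M.dens μ (φ + Complex.I • ψ) x) / 2 ∂μ = _
    rw [integral_div, integral_sub (f := fun x => M.dens μ φ x + M.dens μ ψ x)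
      ((i1 _).add (i1 _)) (i1 _), integral_add (i1 _) (i1 _),
      M.setIntegral_dens μ h _ hX, M.setIntegral_dens μ h _ hX, M.setIntegral_dens μ h _ hX]
    simp only [map_add, map_smul, inner_add_left, inner_add_right, inner_smul_left,
      inner_smul_right, Complex.add_re, Complex.add_im, hc, RCLike.star_def, Complex.mul_re,
      Complex.mul_im,
      Complex.conj_re, Complex.conj_im, Complex.I_re, Complex.I_im]
    ring
  rw [hre, him]
  exact Complex.re_add_im _

/-- Densities are determined by their integrals over measurable sets. Every algebraic identity for
`formDens` is thereby reduced to one for the operators of `M`. -/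
theorem formDens_ae_eq [SigmaFinite μ] (h : M.AbsCont μ) (φ ψ : H) {f : Ω → ℂ}
    (hf : Integrable f μ)
    (hfX : ∀ X, MeasurableSet X → ∫ x in X, f x ∂μ = inner ℂ φ (M.op X ψ)) :
    M.formDens μ φ ψ =ᵐ[μ] f :=
  (M.integrable_formDens μ φ ψ).ae_eq_of_forall_setIntegral_eq _ _ hf fun X hX _ => by
    rw [M.setIntegral_formDens μ h φ ψ hX, hfX X hX]

theorem formDens_add_right [SigmaFinite μ] (h : M.AbsCont μ) (φ ψ χ : H) :
    M.formDens μ φ (ψ + χ) =ᵐ[μ] fun x => M.formDens μ φ ψ x + M.formDens μ φ χ x := by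
  have i1 := fun ξ : H => M.integrable_formDens μ φ ξ
  refine M.formDens_ae_eq μ h _ _ ((i1 _).add (i1 _)) fun X hX => ?_
  rw [integral_add (i1 _).integrableOn (i1 _).integrableOn, M.setIntegral_formDens μ h _ _ hX,
    M.setIntegral_formDens μ h _ _ hX, map_add, inner_add_right]

theorem formDens_smul_right [SigmaFinite μ] (h : M.AbsCont μ) (c : ℂ) (φ ψ : H) :
    M.formDens μ φ (c • ψ) =ᵐ[μ] fun x => c * M.formDens μ φ ψ x := by
  refine M.formDens_ae_eq μ h _ _ ((M.integrable_formDens μ φ ψ).const_mul c) fun X hX => ?_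
  rw [integral_const_mul, M.setIntegral_formDens μ h _ _ hX, map_smul, inner_smul_right]

theorem formDens_comm [SigmaFinite μ] (h : M.AbsCont μ) (φ ψ : H) :
    M.formDens μ φ ψ =ᵐ[μ] fun x => star (M.formDens μ ψ φ x) := by
  refine M.formDens_ae_eq μ h _ _ ?_ fun X hX => ?_
  · exact (Complex.conjLIE.integrable_comp_iff (φ := M.formDens μ ψ φ)).2
      (M.integrable_formDens μ ψ φ)
  · rw [M.inner_op_comm hX, ← M.setIntegral_formDens μ h _ _ hX]
    exact integral_conj

theorem formDens_self [SigmaFinite μ] (h : M.AbsCont μ) (φ : H) :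
    M.formDens μ φ φ =ᵐ[μ] fun x => (M.dens μ φ x : ℂ) := by
  refine M.formDens_ae_eq μ h _ _ (M.integrable_dens μ φ).ofReal fun X hX => ?_
  have hc := M.inner_op_comm hX φ φ
  rw [integral_complex_ofReal, M.setIntegral_dens μ h _ hX]
  exact Complex.conj_eq_iff_re.1 hc.symm

end

end POVM

/-! ### Direct integrals with one-dimensional fibres -/

/-- The zeroth standard basis vector of `ℓ²(ℕ, ℂ)`. -/
def ellTwoZero : EllTwo := lp.single 2 0 (1 : ℂ)

theorem norm_ellTwoZero : ‖ellTwoZero‖ = 1 := by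
  simp [ellTwoZero, lp.norm_single]

theorem inner_ellTwoZero_left (v : EllTwo) : inner ℂ ellTwoZero v = v 0 := by
  simp [ellTwoZero, lp.inner_single_left]

theorem ellTwoZero_mem : ellTwoZero ∈ stdFibre 1 := by
  intro k hk
  have hk' : k ≠ 0 := by rintro rfl; simp at hk
  simp [ellTwoZero, lp.single_apply, hk']

theorem eq_smul_of_mem_stdFibre_one {v : EllTwo} (hv : v ∈ stdFibre 1) :
    v = v 0 • ellTwoZero := by
  ext k
  rcases Nat.eq_zero_or_pos k with rfl | hk
  · simp [ellTwoZero]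
  · have h0 : v k = 0 := hv k (by exact_mod_cast hk)
    simp [ellTwoZero, lp.single_apply, h0, hk.ne']

theorem indicatorMul_coeFn {Ω : Type*} [MeasurableSpace Ω] {μ : Measure Ω} {X : Set Ω}
    (hX : MeasurableSet X) (f : Lp EllTwo 2 μ) :
    indicatorMul μ X hX f =ᵐ[μ] X.indicator f :=
  ((Lp.memLp f).indicator hX).coeFn_toLp

theorem inner_indicatorMul {Ω : Type*} [MeasurableSpace Ω] {μ : Measure Ω} {X : Set Ω}
    (hX : MeasurableSet X) (f g : Lp EllTwo 2 μ) :
    inner ℂ f (indicatorMul μ X hX g) = ∫ x in X, inner ℂ (f x) (g x) ∂μ := by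
  rw [L2.inner_def, ← integral_indicator hX]
  refine integral_congr_ae ?_
  filter_upwards [indicatorMul_coeFn hX g] with x hx
  rw [hx]
  by_cases h : x ∈ X <;> simp [h]

namespace POVM

section

variable {Ω : Type*} [MeasurableSpace Ω] {H : Type*} [NormedAddCommGroup H]
  [InnerProductSpace ℂ H]

/-- The isometry is φ ↦ `w φ` times the basis vector of the fibre. Minimality holds because a vector
orthogonal to the cyclic span has zeroth coordinate orthogonal to every `w (u n)` pointwise, and at
almost every point one of these is nonzero. -/
theorem isRankOne_of_scalar (M : POVM Ω H) (μ : Measure Ω) [SigmaFinite μ] (hμ : M.AbsCont μ)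
    (w : H → Ω → ℂ) (hw : ∀ φ, Measurable (w φ))
    (hadd : ∀ φ ψ, w (φ + ψ) =ᵐ[μ] fun x => w φ x + w ψ x)
    (hsmul : ∀ (c : ℂ) φ, w (c • φ) =ᵐ[μ] fun x => c * w φ x)
    (hL2 : ∀ φ, Integrable (fun x => ‖w φ x‖ ^ 2) μ)
    (hM : ∀ X, MeasurableSet X → ∀ φ ψ,
      ∫ x in X, w ψ x * star (w φ x) ∂μ = inner ℂ φ (M.op X ψ))
    (u : ℕ → H) (hu : ∀ᵐ x ∂μ, ∃ n, w (u n) x ≠ 0) : M.IsRankOne := by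
  have hmem : ∀ φ, MemLp (fun x => w φ x • ellTwoZero) 2 μ := fun φ => by
    rw [memLp_two_iff_integrable_sq_norm (by fun_prop)]
    simpa [norm_smul, norm_ellTwoZero] using hL2 φ
  have hfib : ∀ φ, (hmem φ).toLp _ ∈ directIntegral μ (fun _ => 1) := fun φ => by
    change ∀ᵐ x ∂μ, ((hmem φ).toLp _) x ∈ stdFibre 1
    filter_upwards [(hmem φ).coeFn_toLp] with x hx
    rw [hx]
    exact (stdFibre 1).smul_mem _ ellTwoZero_mem
  let J₀ : H →ₗ[ℂ] directIntegral μ (fun _ => 1) :=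
    { toFun := fun φ => ⟨(hmem φ).toLp _, hfib φ⟩
      map_add' := fun φ ψ => by
        apply Subtype.ext
        apply Lp.ext
        refine Filter.EventuallyEq.trans ?_ (Lp.coeFn_add ((hmem φ).toLp _) ((hmem ψ).toLp _)).symm
        filter_upwards [(hmem φ).coeFn_toLp, (hmem ψ).coeFn_toLp, (hmem (φ + ψ)).coeFn_toLp,
          hadd φ ψ] with x h1 h2 h3 h4
        rw [h3, Pi.add_apply, h1, h2, h4, add_smul]
      map_smul' := fun c φ => by
        apply Subtype.ext
        apply Lp.ext
        refine Filter.EventuallyEq.trans ?_ (Lp.coeFn_smul c ((hmem φ).toLp _)).symm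
        filter_upwards [(hmem φ).coeFn_toLp, (hmem (c • φ)).coeFn_toLp, hsmul c φ] with x h1 h2 h3
        rw [h2, Pi.smul_apply, h1, h3, mul_smul] }
  have hJ : ∀ φ, ((J₀ φ : Lp EllTwo 2 μ) : Ω → EllTwo) =ᵐ[μ] fun x => w φ x • ellTwoZero :=
    fun φ => (hmem φ).coeFn_toLp
  have hdil : ∀ (X : Set Ω) (hX : MeasurableSet X) (φ ψ : H),
      inner ℂ φ (M.op X ψ) = inner ℂ (J₀ φ) (canonicalProj μ (fun _ => 1) X hX (J₀ ψ)) := by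
    intro X hX φ ψ
    change _ = inner ℂ (J₀ φ : Lp EllTwo 2 μ) (indicatorMul μ X hX (J₀ ψ : Lp EllTwo 2 μ))
    rw [inner_indicatorMul, ← hM X hX]
    refine integral_congr_ae (ae_restrict_of_ae ?_)
    filter_upwards [hJ φ, hJ ψ] with x h1 h2
    rw [h1, h2, inner_smul_left, inner_smul_right, inner_self_eq_norm_sq_to_K, norm_ellTwoZero]
    simp [mul_comm]
  have hiso : ∀ φ ψ, inner ℂ (J₀ φ) (J₀ ψ) = inner ℂ φ ψ := by
    intro φ ψ
    have h1 := hdil Set.univ MeasurableSet.univ φ ψ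
    rw [M.univ] at h1
    change inner ℂ φ ψ = _ at h1
    rw [h1]
    congr 1
    apply Subtype.ext
    apply Lp.ext
    refine Filter.EventuallyEq.trans ?_ (indicatorMul_coeFn MeasurableSet.univ _).symm
    simp
  refine ⟨μ, inferInstance, hμ,
    ⟨fun _ => 1, measurable_const, J₀.isometryOfInner hiso, hdil, ?_⟩, by simp⟩
  set S : Set (directIntegral μ (fun _ : Ω => (1 : ℕ∞))) :=
    {f | ∃ (X : Set Ω) (hX : MeasurableSet X) (φ : H),
      f = canonicalProj μ (fun _ => 1) X hX (J₀ φ)} with hS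
  change Dense ((Submodule.span ℂ S : Submodule ℂ (directIntegral μ fun _ : Ω => (1 : ℕ∞))) :
    Set (directIntegral μ fun _ : Ω => (1 : ℕ∞)))
  have hclosure : ∀ f ∈ directIntegral μ (fun _ : Ω => (1 : ℕ∞)),
      f ∈ ((Submodule.span ℂ S).map (directIntegral μ (fun _ => 1)).subtype).topologicalClosure := by
    intro f hf
    rw [← Submodule.orthogonal_orthogonal_eq_closure, Submodule.mem_orthogonal]
    -- Here `g` lies in the ambient L² space and not necessarily in the direct integral, so only its
    -- zeroth coordinate is controlled; that is all that pairs with `f`.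
    intro g hg
    have hg0 : ∀ᵐ x ∂μ, ∀ n, w (u n) x * star (g x 0) = 0 := by
      rw [ae_all_iff]
      intro n
      have hint : Integrable (fun x => w (u n) x * star (g x 0)) μ := by
        refine (L2.integrable_inner (𝕜 := ℂ) g (J₀ (u n) : Lp EllTwo 2 μ)).congr ?_
        filter_upwards [hJ (u n)] with x hx
        rw [hx, inner_smul_right, ← inner_conj_symm, inner_ellTwoZero_left]
        rfl
      refine hint.ae_eq_of_forall_setIntegral_eq _ (fun _ => 0) (integrable_zero _ _ _)
        fun X hX _ => ?_
      have h0 := (Submodule.mem_orthogonal' _ _).1 hg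
        (indicatorMul μ X hX (J₀ (u n) : Lp EllTwo 2 μ))
        ⟨canonicalProj μ (fun _ => 1) X hX (J₀ (u n)),
          Submodule.subset_span ⟨X, hX, u n, rfl⟩, rfl⟩
      rw [inner_indicatorMul] at h0
      rw [integral_zero, ← h0]
      refine integral_congr_ae (ae_restrict_of_ae ?_)
      filter_upwards [hJ (u n)] with x hx
      rw [hx, inner_smul_right, ← inner_conj_symm, inner_ellTwoZero_left]
      rfl
    rw [L2.inner_def]
    refine integral_eq_zero_of_ae ?_
    have hf' : ∀ᵐ x ∂μ, f x ∈ stdFibre 1 := hf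
    filter_upwards [hf', hg0, hu] with x h1 h2 ⟨n, hn⟩
    have hgx : g x 0 = 0 := by simpa [hn] using h2 n
    rw [eq_smul_of_mem_stdFibre_one h1, inner_smul_right, ← inner_conj_symm,
      inner_ellTwoZero_left, hgx]
    simp
  intro f
  rw [closure_subtype]
  exact hclosure f f.2

/-! ### Factoring a density form of rank one -/

/-- The set where all the densities vanish is null for each outcome measure, hence for their sum,
which dominates `μ`. -/
theorem exists_dens_pos (M : POVM Ω H) (μ : Measure Ω) [SigmaFinite μ] (hμ : M.AbsCont μ)
    {u : ℕ → H} (hu : μ ≪ Measure.sum fun n => M.outcome (u n)) :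
    ∀ᵐ x ∂μ, ∃ n, 0 < M.dens μ (u n) x := by
  have hC : MeasurableSet {x | ∀ n, M.dens μ (u n) x = 0} := by
    refine measurableSet_setOfPred.2 (Measurable.forall fun n => ?_)
    exact measurableSet_setOfPred.1 (measurableSet_eq_fun (M.measurable_dens μ (u n)) measurable_const)
  have h0 : μ {x | ∀ n, M.dens μ (u n) x = 0} = 0 := by
    refine hu ?_
    rw [Measure.sum_apply _ hC, ENNReal.tsum_eq_zero]
    intro n
    have h1 : (M.outcome (u n)).real {x | ∀ n, M.dens μ (u n) x = 0} = 0 := by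
      rw [M.outcome_real_apply _ hC, ← M.setIntegral_dens μ hμ _ hC]
      exact setIntegral_eq_zero_of_forall_eq_zero fun x hx => hx n
    simpa [Measure.real, ENNReal.toReal_eq_zero_iff] using h1
  filter_upwards [measure_eq_zero_iff_ae_notMem.1 h0] with x hx
  simp only [not_forall] at hx
  exact hx.imp fun n hn => lt_of_le_of_ne (M.dens_nonneg μ _ x) (Ne.symm hn)

theorem exists_measurable_pivot (M : POVM Ω H) (μ : Measure Ω) [SigmaFinite μ]
    (hμ : M.AbsCont μ) {u : ℕ → H} (hu : μ ≪ Measure.sum fun n => M.outcome (u n)) :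
    ∃ idx : Ω → ℕ, Measurable idx ∧ ∀ᵐ x ∂μ, 0 < M.dens μ (u (idx x)) x := by
  classical
  -- The second alternative makes the search for an index total on the exceptional null set.
  let p : Ω → ℕ → Prop := fun x n => 0 < M.dens μ (u n) x ∨ ∀ k, ¬ 0 < M.dens μ (u k) x
  have hp : ∀ x, ∃ n, p x n := fun x => by
    by_cases hx : ∃ n, 0 < M.dens μ (u n) x
    · exact hx.imp fun n hn => Or.inl hn
    · exact ⟨0, Or.inr (not_exists.1 hx)⟩
  have hpm : ∀ k, MeasurableSet {x | p x k} := fun k => by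
    have hm : ∀ n, Measurable fun x => 0 < M.dens μ (u n) x := fun n =>
      measurableSet_setOfPred.1 (measurableSet_lt measurable_const (M.measurable_dens μ (u n)))
    exact measurableSet_setOfPred.2 ((hm k).or (Measurable.forall fun n => (hm n).not))
  refine ⟨fun x => Nat.find (hp x), measurable_find hp hpm, ?_⟩
  filter_upwards [M.exists_dens_pos μ hμ hu] with x ⟨n, hn⟩
  exact (Nat.find_spec (hp x)).resolve_right fun hk => hk n hn

/-- A rank one positive matrix is recovered from the row of a positive diagonal entry, divided by
the square root of that entry. -/
theorem exists_scalar_factorization (M : POVM Ω H) (μ : Measure Ω) [SigmaFinite μ]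
    (hμ : M.AbsCont μ) {u : ℕ → H} (hu : μ ≪ Measure.sum fun n => M.outcome (u n))
    (h : ∀ φ ψ χ, ∀ᵐ x ∂μ, M.formDens μ φ χ x * M.formDens μ χ ψ x =
      M.formDens μ χ χ x * M.formDens μ φ ψ x) :
    ∃ w : H → Ω → ℂ, (∀ φ, Measurable (w φ)) ∧
      (∀ φ ψ, w (φ + ψ) =ᵐ[μ] fun x => w φ x + w ψ x) ∧
      (∀ (c : ℂ) φ, w (c • φ) =ᵐ[μ] fun x => c * w φ x) ∧
      ∀ φ ψ, ∀ᵐ x ∂μ, w ψ x * star (w φ x) = M.formDens μ φ ψ x := by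
  obtain ⟨idx, hidx, hidx_pos⟩ := M.exists_measurable_pivot μ hμ hu
  refine ⟨fun φ x => M.formDens μ (u (idx x)) φ x / (Real.sqrt (M.dens μ (u (idx x)) x) : ℂ),
    fun φ => ?_, fun φ ψ => ?_, fun c φ => ?_, fun φ ψ => ?_⟩
  · exact ((measurable_from_prod_countable_right (f := fun q : ℕ × Ω => M.formDens μ (u q.1) φ q.2)
      fun n => M.measurable_formDens μ (u n) φ).comp (hidx.prodMk measurable_id)).div
      (Complex.measurable_ofReal.comp (((measurable_from_prod_countable_right
        (f := fun q : ℕ × Ω => M.dens μ (u q.1) q.2) fun n => M.measurable_dens μ (u n)).comp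
        (hidx.prodMk measurable_id)).sqrt))
  -- The relation holds off one null set for all `n`, so it may be used at the point-dependent index
  -- `idx x`.
  · filter_upwards [ae_all_iff.2 fun n => M.formDens_add_right μ hμ (u n) φ ψ] with x hx
    rw [hx, add_div]
  · filter_upwards [ae_all_iff.2 fun n => M.formDens_smul_right μ hμ c (u n) φ] with x hx
    rw [hx, mul_div_assoc]
  · filter_upwards [hidx_pos, ae_all_iff.2 fun n => h φ ψ (u n),
      ae_all_iff.2 fun n => M.formDens_comm μ hμ φ (u n),
      ae_all_iff.2 fun n => M.formDens_self μ hμ (u n)] with x h1 h2 h3 h4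
    have hs : (Real.sqrt (M.dens μ (u (idx x)) x) : ℂ) ≠ 0 := by
      exact_mod_cast (Real.sqrt_pos.2 h1).ne'
    have hs2 : (Real.sqrt (M.dens μ (u (idx x)) x) : ℂ) * (Real.sqrt (M.dens μ (u (idx x)) x) : ℂ)
        = M.formDens μ (u (idx x)) (u (idx x)) x := by
      rw [h4, ← Complex.ofReal_mul, Real.mul_self_sqrt h1.le]
    rw [star_div₀, ← h3]
    rw [show star (Real.sqrt (M.dens μ (u (idx x)) x) : ℂ) = _ from Complex.conj_ofReal _,
      div_mul_div_comm, div_eq_iff (mul_ne_zero hs hs), hs2, mul_comm, h2, mul_comm]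

theorem isRankOne_of_formDens_mul (M : POVM Ω H) (μ : Measure Ω) [SigmaFinite μ]
    (hμ : M.AbsCont μ) {u : ℕ → H} (hu : μ ≪ Measure.sum fun n => M.outcome (u n))
    (h : ∀ φ ψ χ, ∀ᵐ x ∂μ, M.formDens μ φ χ x * M.formDens μ χ ψ x =
      M.formDens μ χ χ x * M.formDens μ φ ψ x) : M.IsRankOne := by
  obtain ⟨w, hw, hadd, hsmul, hprod⟩ := M.exists_scalar_factorization μ hμ hu h
  refine M.isRankOne_of_scalar μ hμ w hw hadd hsmul ?_ ?_ u ?_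
  · intro φ
    refine (M.integrable_dens μ φ).congr ?_
    filter_upwards [hprod φ φ, M.formDens_self μ hμ φ] with x h1 h2
    rw [h2, RCLike.star_def, Complex.mul_conj, Complex.normSq_eq_norm_sq] at h1
    exact_mod_cast h1.symm
  · intro X hX φ ψ
    rw [← M.setIntegral_formDens μ hμ φ ψ hX]
    exact integral_congr_ae (ae_restrict_of_ae (hprod φ ψ))
  · filter_upwards [M.exists_dens_pos μ hμ hu, ae_all_iff.2 fun n => hprod (u n) (u n),
      ae_all_iff.2 fun n => M.formDens_self μ hμ (u n)] with x ⟨n, hn⟩ h1 h2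
    refine ⟨n, fun h0 => hn.ne' ?_⟩
    have := h1 n
    rw [h0, zero_mul, h2] at this
    exact_mod_cast this.symm

/-- The outcome measures of a rank 1 observable have densities `‖v φ‖ ^ 2` where `v` is
linear in `φ` almost everywhere. -/
theorem IsRankOne.exists_density_vector {M : POVM Ω H} (hM : M.IsRankOne) :
    ∃ (μ : Measure Ω) (v : H → Ω → ℂ), SigmaFinite μ ∧ M.AbsCont μ ∧ (∀ φ, Measurable (v φ)) ∧
      (∀ φ ψ, v (φ + ψ) =ᵐ[μ] fun x => v φ x + v ψ x) ∧
      (∀ (c : ℂ) φ, v (c • φ) =ᵐ[μ] fun x => c * v φ x) ∧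
      ∀ φ, M.outcome φ = μ.withDensity fun x => ENNReal.ofReal (‖v φ x‖ ^ 2) := by
  obtain ⟨μ, hσ, hμ, D, hm⟩ := hM
  refine ⟨μ, fun φ x => inner ℂ ellTwoZero ((D.J φ : Lp EllTwo 2 μ) x), hσ, hμ, fun φ => ?_,
    fun φ ψ => ?_, fun c φ => ?_, fun φ => ?_⟩
  · exact (stronglyMeasurable_const.inner
      (Lp.stronglyMeasurable (D.J φ : Lp EllTwo 2 μ))).measurable
  · simp only [map_add]
    filter_upwards [Lp.coeFn_add (D.J φ : Lp EllTwo 2 μ) (D.J ψ : Lp EllTwo 2 μ)] with x hx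
    rw [Submodule.coe_add, hx, Pi.add_apply, inner_add_right]
  · simp only [map_smul]
    filter_upwards [Lp.coeFn_smul c (D.J φ : Lp EllTwo 2 μ)] with x hx
    rw [Submodule.coe_smul, hx, Pi.smul_apply, inner_smul_right]
  · ext X hX
    have hf : ∀ᵐ x ∂μ, (D.J φ : Lp EllTwo 2 μ) x ∈ stdFibre (D.m x) := (D.J φ).2
    have hdil : inner ℂ φ (M.op X φ) = ∫ x in X, inner ℂ ((D.J φ : Lp EllTwo 2 μ) x)
        ((D.J φ : Lp EllTwo 2 μ) x) ∂μ :=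
      (D.dilation X hX φ φ).trans (inner_indicatorMul hX _ _)
    have hnorm : ∀ᵐ x ∂μ, inner ℂ ((D.J φ : Lp EllTwo 2 μ) x) ((D.J φ : Lp EllTwo 2 μ) x) =
        ((‖inner ℂ ellTwoZero ((D.J φ : Lp EllTwo 2 μ) x)‖ ^ 2 : ℝ) : ℂ) := by
      filter_upwards [hf, hm] with x h1 h2
      rw [h2] at h1
      rw [inner_self_eq_norm_sq_to_K]
      conv_lhs => rw [eq_smul_of_mem_stdFibre_one h1]
      rw [norm_smul, norm_ellTwoZero, mul_one, inner_ellTwoZero_left]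
      simp
    have hint : Integrable
        (fun x => ‖inner ℂ ellTwoZero ((D.J φ : Lp EllTwo 2 μ) x)‖ ^ 2) μ := by
      have h1 := (L2.integrable_inner (𝕜 := ℂ) (D.J φ : Lp EllTwo 2 μ) (D.J φ)).congr hnorm
      exact h1.re
    rw [M.outcome_apply φ hX, withDensity_apply _ hX, hdil,
      integral_congr_ae (ae_restrict_of_ae hnorm), integral_complex_ofReal, Complex.ofReal_re,
      ofReal_integral_eq_lintegral_ofReal hint.integrableOn
        (Filter.Eventually.of_forall fun x => by positivity)]

/-! ### Pointwise positivity of the density form -/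

theorem dens_linear_combination (M : POVM Ω H) (μ : Measure Ω) [SigmaFinite μ] (hμ : M.AbsCont μ)
    (a b : ℂ) (φ ψ : H) :
    ∀ᵐ x ∂μ, M.dens μ (a • φ + b • ψ) x = ‖a‖ ^ 2 * M.dens μ φ x + ‖b‖ ^ 2 * M.dens μ ψ x +
      2 * (star a * b * M.formDens μ φ ψ x).re := by
  set ξ := a • φ + b • ψ with hξ
  filter_upwards [M.formDens_self μ hμ ξ, M.formDens_add_right μ hμ ξ (a • φ) (b • ψ),
    M.formDens_smul_right μ hμ a ξ φ, M.formDens_smul_right μ hμ b ξ ψ,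
    M.formDens_comm μ hμ ξ φ, M.formDens_comm μ hμ ξ ψ,
    M.formDens_add_right μ hμ φ (a • φ) (b • ψ), M.formDens_add_right μ hμ ψ (a • φ) (b • ψ),
    M.formDens_smul_right μ hμ a φ φ, M.formDens_smul_right μ hμ b φ ψ,
    M.formDens_smul_right μ hμ a ψ φ, M.formDens_smul_right μ hμ b ψ ψ,
    M.formDens_comm μ hμ ψ φ, M.formDens_self μ hμ φ, M.formDens_self μ hμ ψ] with
    x h1 h2 h3 h4 h5 h6 h7 h8 h9 h10 h11 h12 h13 h14 h15
  rw [← hξ] at h2 h7 h8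
  rw [h2, h3, h4, h5, h6, h7, h8, h9, h10, h11, h12, h13, h14, h15] at h1
  have h := congrArg Complex.re h1
  rw [Complex.ofReal_re] at h
  rw [← h, ← Complex.normSq_eq_norm_sq, ← Complex.normSq_eq_norm_sq]
  simp only [Complex.normSq_apply, RCLike.star_def, map_add, map_mul, Complex.add_re,
    Complex.mul_re, Complex.mul_im, Complex.add_im, Complex.conj_re, Complex.conj_im,
    Complex.ofReal_re, Complex.ofReal_im]
  ring

/-- The null set must not depend on `a` and `b`, since they will later be functions of y. Countably
many pairs are treated first, and continuity gives the rest. -/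
theorem dens_form_nonneg (M : POVM Ω H) (μ : Measure Ω) [SigmaFinite μ] (hμ : M.AbsCont μ)
    (φ ψ : H) :
    ∀ᵐ x ∂μ, ∀ a b : ℂ, 0 ≤ ‖a‖ ^ 2 * M.dens μ φ x + ‖b‖ ^ 2 * M.dens μ ψ x +
      2 * (star a * b * M.formDens μ φ ψ x).re := by
  have h := ae_all_iff.2 fun n => M.dens_linear_combination μ hμ
    (TopologicalSpace.denseSeq (ℂ × ℂ) n).1 (TopologicalSpace.denseSeq (ℂ × ℂ) n).2 φ ψ
  filter_upwards [h] with x hx a b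
  have hcl : IsClosed {p : ℂ × ℂ | 0 ≤ ‖p.1‖ ^ 2 * M.dens μ φ x + ‖p.2‖ ^ 2 * M.dens μ ψ x +
      2 * (star p.1 * p.2 * M.formDens μ φ ψ x).re} :=
    isClosed_le continuous_const (by fun_prop)
  refine (TopologicalSpace.denseRange_denseSeq (ℂ × ℂ)).induction_on (p := fun p : ℂ × ℂ =>
    0 ≤ ‖p.1‖ ^ 2 * M.dens μ φ x + ‖p.2‖ ^ 2 * M.dens μ ψ x +
      2 * (star p.1 * p.2 * M.formDens μ φ ψ x).re) (a, b) hcl fun n => ?_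
  rw [← hx n]
  exact M.dens_nonneg μ _ x

end

/-- Nonnegativity gives R² ≤ PQ; with 2R = −(P + Q) this becomes (P − Q)² ≤ 0. -/
theorem eq_of_quadratic_nonneg {P Q R : ℝ} (hP : 0 ≤ P) (hQ : 0 ≤ Q)
    (h : ∀ t : ℝ, 0 ≤ t ^ 2 * P + Q + 2 * t * R) (h1 : P + Q + 2 * R = 0) : P = Q := by
  have hd := discrim_le_zero (a := P) (b := 2 * R) (c := Q) fun t => by linarith [h t]
  rw [discrim] at hd
  nlinarith [sq_nonneg (P - Q)]

/-! ### Post-processing and the joint measure on Ω₁ × Ω₂ -/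

section

variable {Ω₁ Ω₂ : Type*} [MeasurableSpace Ω₁] [MeasurableSpace Ω₂] {H : Type*}
  [NormedAddCommGroup H] [InnerProductSpace ℂ H] {M₁ : POVM Ω₁ H} {β : Kernel Ω₁ Ω₂}
  [IsMarkovKernel β] {M₂ : POVM Ω₂ H}

theorem IsPostProcessing.outcome_eq (h : M₁.IsPostProcessing β M₂) (φ : H) :
    M₂.outcome φ = β ∘ₘ M₁.outcome φ := by
  ext Y hY
  have hint : Integrable (fun x => (β x).real Y) (M₁.outcome φ) :=
    Integrable.of_bound (Kernel.measurable_coe β hY).ennreal_toReal.aestronglyMeasurable 1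
      (Filter.Eventually.of_forall fun x => by
        rw [Real.norm_of_nonneg measureReal_nonneg]; exact measureReal_le_one)
  rw [M₂.outcome_apply φ hY, h Y hY φ, Complex.ofReal_re, Measure.bind_apply hY (by fun_prop),
    ofReal_integral_eq_lintegral_ofReal hint
      (Filter.Eventually.of_forall fun x => measureReal_nonneg)]
  simp

/-- The second marginal of the joint measure is `β ∘ₘ μ₁`, which is dominated by the sum of the
outcome measures of `M₂`. -/
theorem IsPostProcessing.ae_compProd_snd (h : M₁.IsPostProcessing β M₂) {μ₁ : Measure Ω₁}
    [SFinite μ₁] {u : ℕ → H} (hu : μ₁ ≪ Measure.sum fun n => M₁.outcome (u n)) {p : Ω₂ → Prop}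
    (hp : ∀ n, ∀ᵐ y ∂M₂.outcome (u n), p y) : ∀ᵐ q ∂(μ₁ ⊗ₘ β), p q.2 := by
  have h1 : ∀ᵐ y ∂(β ∘ₘ μ₁), p y := by
    have h2 : ∀ᵐ y ∂(β ∘ₘ Measure.sum fun n => M₁.outcome (u n)), p y := by
      have hN : MeasurableSet (toMeasurable (Measure.sum fun n => M₂.outcome (u n)) {y | ¬ p y}) :=
        measurableSet_toMeasurable _ _
      have h0 : (Measure.sum fun n => M₂.outcome (u n)) {y | ¬ p y} = 0 := by
        rw [Measure.sum_apply_of_countable, ENNReal.tsum_eq_zero]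
        exact hp
      refine measure_mono_null
        (subset_toMeasurable (Measure.sum fun n => M₂.outcome (u n)) {y | ¬ p y}) ?_
      rw [← measure_toMeasurable, Measure.sum_apply _ hN, ENNReal.tsum_eq_zero] at h0
      rw [Measure.bind_apply hN (by fun_prop), lintegral_sum_measure, ENNReal.tsum_eq_zero]
      intro n
      rw [← Measure.bind_apply hN (by fun_prop), ← h.outcome_eq]
      exact h0 n
    exact (hu.comp_right β).ae_le h2
  rw [← Measure.snd_compProd] at h1
  exact ae_of_ae_map measurable_snd.aemeasurable h1

theorem integrable_mul_dens (μ₁ : Measure Ω₁) [SFinite μ₁] (φ : H) {k : Ω₂ → ℝ}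
    (hk : Measurable k) {C : ℝ} (hC : ∀ y, |k y| ≤ C) :
    Integrable (fun q : Ω₁ × Ω₂ => k q.2 * M₁.dens μ₁ φ q.1) (μ₁ ⊗ₘ β) := by
  have h1 : Integrable (fun q : Ω₁ × Ω₂ => M₁.dens μ₁ φ q.1) (μ₁ ⊗ₘ β) := by
    have h2 : Integrable (M₁.dens μ₁ φ) (μ₁ ⊗ₘ β).fst := by
      rw [Measure.fst_compProd]
      exact M₁.integrable_dens μ₁ φ
    exact h2.comp_measurable measurable_fst
  exact h1.bdd_mul (hk.comp measurable_snd).aestronglyMeasurable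
    (Filter.Eventually.of_forall fun q => hC q.2)

/-- Weighting the joint measure by the density of φ makes its second marginal the outcome measure of
φ under `M₂`. -/
theorem IsPostProcessing.integral_mul_dens (h : M₁.IsPostProcessing β M₂) {μ₁ : Measure Ω₁}
    [SigmaFinite μ₁] (hμ₁ : M₁.AbsCont μ₁) {μ₂ : Measure Ω₂} {φ : H} {v : Ω₂ → ℂ}
    (hv : Measurable v)
    (hvφ : M₂.outcome φ = μ₂.withDensity fun y => ENNReal.ofReal (‖v y‖ ^ 2)) {k : Ω₂ → ℝ}
    (hk : Measurable k) {C : ℝ} (hC : ∀ y, |k y| ≤ C) :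
    Integrable (fun y => k y * ‖v y‖ ^ 2) μ₂ ∧
    ∫ q, k q.2 * M₁.dens μ₁ φ q.1 ∂(μ₁ ⊗ₘ β) = ∫ y, k y * ‖v y‖ ^ 2 ∂μ₂ := by
  have hvm : Measurable fun y => ENNReal.ofReal (‖v y‖ ^ 2) := by fun_prop
  have hlt : ∀ᵐ y ∂μ₂, ENNReal.ofReal (‖v y‖ ^ 2) < ∞ :=
    Filter.Eventually.of_forall fun y => ENNReal.ofReal_lt_top
  have hkint : Integrable k (M₂.outcome φ) :=
    Integrable.of_bound hk.aestronglyMeasurable C (Filter.Eventually.of_forall hC)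
  constructor
  · rw [hvφ, integrable_withDensity_iff hvm hlt] at hkint
    refine hkint.congr (Filter.Eventually.of_forall fun y => ?_)
    simp only
    rw [ENNReal.toReal_ofReal (by positivity)]
  · have e1 : ∫ y, k y * ‖v y‖ ^ 2 ∂μ₂ = ∫ y, k y ∂(M₂.outcome φ) := by
      rw [hvφ, integral_withDensity_eq_integral_toReal_smul hvm hlt]
      refine integral_congr_ae (Filter.Eventually.of_forall fun y => ?_)
      simp only
      rw [ENNReal.toReal_ofReal (by positivity), smul_eq_mul, mul_comm]
    rw [e1, h.outcome_eq, Measure.integral_compProd (M₁.integrable_mul_dens μ₁ φ hk hC)]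
    rw [h.outcome_eq] at hkint
    rw [Measure.comp_eq_comp_const_apply] at hkint ⊢
    rw [Kernel.integral_comp hkint, Kernel.const_apply,
      ← integral_rnDeriv_smul (hμ₁.outcome φ)]
    refine integral_congr_ae (Filter.Eventually.of_forall fun x => ?_)
    simp only [smul_eq_mul, integral_mul_const]
    exact mul_comm _ _

theorem IsPostProcessing.norm_sq_mul_dens_comm_of_bounded (h : M₁.IsPostProcessing β M₂)
    {μ₁ : Measure Ω₁} [SigmaFinite μ₁] (hμ₁ : M₁.AbsCont μ₁) {μ₂ : Measure Ω₂}
    {v : H → Ω₂ → ℂ} (hv : ∀ φ, Measurable (v φ))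
    (hadd : ∀ φ ψ, v (φ + ψ) =ᵐ[μ₂] fun y => v φ y + v ψ y)
    (hsmul : ∀ (c : ℂ) φ, v (c • φ) =ᵐ[μ₂] fun y => c * v φ y)
    (hvM : ∀ φ, M₂.outcome φ = μ₂.withDensity fun y => ENNReal.ofReal (‖v φ y‖ ^ 2))
    (φ ψ : H) (K : ℕ) :
    ∀ᵐ q ∂(μ₁ ⊗ₘ β), ‖v φ q.2‖ ≤ K → ‖v ψ q.2‖ ≤ K →
      ‖v ψ q.2‖ ^ 2 * M₁.dens μ₁ φ q.1 = ‖v φ q.2‖ ^ 2 * M₁.dens μ₁ ψ q.1 := by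
  -- Truncation to `S` makes the multipliers bounded, as `integral_mul_dens` requires; each of the
  -- three terms in `A` and `B` is at most `K ^ 2` there.
  let S : Set Ω₂ := {y | ‖v φ y‖ ≤ K ∧ ‖v ψ y‖ ≤ K}
  have hS : MeasurableSet S :=
    (measurableSet_le (hv φ).norm measurable_const).inter
      (measurableSet_le (hv ψ).norm measurable_const)
  let c : Ω₂ → ℂ := fun y => star (v ψ y) * (-v φ y)
  have hc : Measurable c := by
    have := hv φ
    have := hv ψ
    fun_prop
  have hcS : ∀ y ∈ S, ‖c y‖ ≤ (K : ℝ) ^ 2 := fun y hy => by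
    rw [norm_mul, norm_star, norm_neg, sq]
    exact mul_le_mul hy.2 hy.1 (norm_nonneg _) (Nat.cast_nonneg _)
  have hbd : ∀ (f : Ω₂ → ℝ), (∀ y ∈ S, |f y| ≤ 3 * (K : ℝ) ^ 2) →
      ∀ y, |S.indicator f y| ≤ 3 * (K : ℝ) ^ 2 := fun f hf y => by
    by_cases hy : y ∈ S
    · simpa [hy] using hf y hy
    · simp only [hy, not_false_eq_true, Set.indicator_of_notMem, abs_zero]
      positivity
  -- The test vector v_ψ(y)φ − v_φ(y)ψ depends on y, while post-processing is known for fixed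
  -- vectors only. Polarization rewrites the form on it as a combination of the densities of φ, ψ, φ
  -- + ψ and φ + iψ, with coefficients `A`, `B`, `C`, `D` depending on y alone.
  let A : Ω₂ → ℝ := S.indicator fun y => ‖v ψ y‖ ^ 2 - (c y).re - (c y).im
  let B : Ω₂ → ℝ := S.indicator fun y => ‖v φ y‖ ^ 2 - (c y).re - (c y).im
  let C : Ω₂ → ℝ := S.indicator fun y => (c y).re
  let D : Ω₂ → ℝ := S.indicator fun y => (c y).im
  have hA : Measurable A := Measurable.indicator (by have := hv ψ; fun_prop) hS
  have hB : Measurable B := Measurable.indicator (by have := hv φ; fun_prop) hS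
  have hC : Measurable C := Measurable.indicator (by fun_prop) hS
  have hD : Measurable D := Measurable.indicator (by fun_prop) hS
  have bA : ∀ y, |A y| ≤ 3 * (K : ℝ) ^ 2 := hbd _ fun y hy => by
    have h1 := hcS y hy
    have h2 := abs_le.1 (Complex.abs_re_le_norm (c y))
    have h3 := abs_le.1 (Complex.abs_im_le_norm (c y))
    have h4 := pow_le_pow_left₀ (norm_nonneg _) hy.2 2
    have h5 := sq_nonneg ‖v ψ y‖
    rw [abs_le]; constructor <;> linarith
  have bB : ∀ y, |B y| ≤ 3 * (K : ℝ) ^ 2 := hbd _ fun y hy => by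
    have h1 := hcS y hy
    have h2 := abs_le.1 (Complex.abs_re_le_norm (c y))
    have h3 := abs_le.1 (Complex.abs_im_le_norm (c y))
    have h4 := pow_le_pow_left₀ (norm_nonneg _) hy.1 2
    have h5 := sq_nonneg ‖v φ y‖
    rw [abs_le]; constructor <;> linarith
  have bC : ∀ y, |C y| ≤ 3 * (K : ℝ) ^ 2 := hbd _ fun y hy => by
    linarith [hcS y hy, Complex.abs_re_le_norm (c y), sq_nonneg (K : ℝ)]
  have bD : ∀ y, |D y| ≤ 3 * (K : ℝ) ^ 2 := hbd _ fun y hy => by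
    linarith [hcS y hy, Complex.abs_im_le_norm (c y), sq_nonneg (K : ℝ)]
  obtain ⟨jA, eA⟩ := h.integral_mul_dens hμ₁ (hv φ) (hvM φ) hA bA
  obtain ⟨jB, eB⟩ := h.integral_mul_dens hμ₁ (hv ψ) (hvM ψ) hB bB
  obtain ⟨jC, eC⟩ := h.integral_mul_dens hμ₁ (hv (φ + ψ)) (hvM (φ + ψ)) hC bC
  obtain ⟨jD, eD⟩ := h.integral_mul_dens hμ₁ (hv (φ + Complex.I • ψ)) (hvM _) hD bD
  have iA := M₁.integrable_mul_dens (β := β) μ₁ φ hA bA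
  have iB := M₁.integrable_mul_dens (β := β) μ₁ ψ hB bB
  have iC := M₁.integrable_mul_dens (β := β) μ₁ (φ + ψ) hC bC
  have iD := M₁.integrable_mul_dens (β := β) μ₁ (φ + Complex.I • ψ) hD bD
  let F : Ω₁ × Ω₂ → ℝ := fun q => A q.2 * M₁.dens μ₁ φ q.1 + B q.2 * M₁.dens μ₁ ψ q.1 +
    C q.2 * M₁.dens μ₁ (φ + ψ) q.1 + D q.2 * M₁.dens μ₁ (φ + Complex.I • ψ) q.1
  have hFint : Integrable F (μ₁ ⊗ₘ β) := ((iA.add iB).add iC).add iD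
  have hF0 : ∫ q, F q ∂(μ₁ ⊗ₘ β) = 0 := by
    have e1 : ∫ q, F q ∂(μ₁ ⊗ₘ β) = ∫ y, (A y * ‖v φ y‖ ^ 2 + B y * ‖v ψ y‖ ^ 2 +
        C y * ‖v (φ + ψ) y‖ ^ 2 + D y * ‖v (φ + Complex.I • ψ) y‖ ^ 2) ∂μ₂ := by
      have s1 := integral_add ((iA.add iB).add iC) iD
      have s2 := integral_add (iA.add iB) iC
      have s3 := integral_add iA iB
      have t1 := integral_add ((jA.add jB).add jC) jD
      have t2 := integral_add (jA.add jB) jC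
      have t3 := integral_add jA jB
      simp only [Pi.add_apply] at s1 s2 t1 t2
      rw [t1, t2, t3, ← eA, ← eB, ← eC, ← eD, ← s3, ← s2, ← s1]
    rw [e1]
    refine integral_eq_zero_of_ae ?_
    filter_upwards [hadd φ ψ, hadd φ (Complex.I • ψ), hsmul Complex.I ψ] with y h1 h2 h3
    by_cases hy : y ∈ S
    · simp only [A, B, C, D, Set.indicator_of_mem hy, h1, h2, h3, ← Complex.normSq_eq_norm_sq]
      simp only [c, Complex.normSq_apply, RCLike.star_def, Complex.add_re,
        Complex.mul_re, Complex.mul_im, Complex.add_im, Complex.conj_re, Complex.conj_im,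
        Complex.neg_re, Complex.neg_im, Complex.I_re, Complex.I_im, Pi.zero_apply]
      ring
    · simp [A, B, C, D, hy]
  have hFS : ∀ q : Ω₁ × Ω₂, q.2 ∈ S → F q = ‖v ψ q.2‖ ^ 2 * M₁.dens μ₁ φ q.1 +
      ‖-v φ q.2‖ ^ 2 * M₁.dens μ₁ ψ q.1 +
      2 * (star (v ψ q.2) * (-v φ q.2) * M₁.formDens μ₁ φ ψ q.1).re := fun q hq => by
    simp only [F, A, B, C, D, Set.indicator_of_mem hq, norm_neg]
    change _ = _ + _ + 2 * (c q.2 * M₁.formDens μ₁ φ ψ q.1).re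
    rw [Complex.mul_re (c q.2)]
    simp only [formDens]
    ring
  have hform : ∀ᵐ q ∂(μ₁ ⊗ₘ β), ∀ a b : ℂ, 0 ≤ ‖a‖ ^ 2 * M₁.dens μ₁ φ q.1 +
      ‖b‖ ^ 2 * M₁.dens μ₁ ψ q.1 + 2 * (star a * b * M₁.formDens μ₁ φ ψ q.1).re := by
    have hlift : ∀ {p : Ω₁ → Prop}, (∀ᵐ x ∂μ₁, p x) → ∀ᵐ q ∂(μ₁ ⊗ₘ β), p q.1 := fun hp =>
      ae_of_ae_map measurable_fst.aemeasurable (by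
        rwa [← Measure.fst, Measure.fst_compProd])
    exact hlift (M₁.dens_form_nonneg μ₁ hμ₁ φ ψ)
  have hFnonneg : 0 ≤ᵐ[μ₁ ⊗ₘ β] F := by
    filter_upwards [hform] with q hq
    by_cases hy : q.2 ∈ S
    · rw [hFS q hy]
      exact hq _ _
    · simp [F, A, B, C, D, hy]
  filter_upwards [hform, (integral_eq_zero_iff_of_nonneg_ae hFnonneg hFint).1 hF0]
    with q hq hq0 hφ hψ
  have hy : q.2 ∈ S := ⟨hφ, hψ⟩
  rw [hFS q hy, norm_neg, Pi.zero_apply] at hq0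
  refine eq_of_quadratic_nonneg (mul_nonneg (by positivity) (M₁.dens_nonneg μ₁ _ _))
    (mul_nonneg (by positivity) (M₁.dens_nonneg μ₁ _ _)) (fun t => ?_) hq0
  -- Scaling only the first coefficient by t produces the quadratic polynomial; t = 1 is the test
  -- vector itself.
  have ht := hq (t * v ψ q.2) (-v φ q.2)
  have e : star ((t : ℂ) * v ψ q.2) * (-v φ q.2) * M₁.formDens μ₁ φ ψ q.1 =
      (t : ℂ) * (star (v ψ q.2) * (-v φ q.2) * M₁.formDens μ₁ φ ψ q.1) := by
    simp only [star_mul', RCLike.star_def, Complex.conj_ofReal]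
    ring
  rw [e, Complex.re_ofReal_mul, norm_neg, norm_mul, mul_pow, Complex.norm_real, Real.norm_eq_abs,
    sq_abs] at ht
  linarith

theorem IsPostProcessing.norm_sq_mul_dens_comm (h : M₁.IsPostProcessing β M₂)
    {μ₁ : Measure Ω₁} [SigmaFinite μ₁] (hμ₁ : M₁.AbsCont μ₁) {μ₂ : Measure Ω₂}
    {v : H → Ω₂ → ℂ} (hv : ∀ φ, Measurable (v φ))
    (hadd : ∀ φ ψ, v (φ + ψ) =ᵐ[μ₂] fun y => v φ y + v ψ y)
    (hsmul : ∀ (c : ℂ) φ, v (c • φ) =ᵐ[μ₂] fun y => c * v φ y)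
    (hvM : ∀ φ, M₂.outcome φ = μ₂.withDensity fun y => ENNReal.ofReal (‖v φ y‖ ^ 2))
    (φ ψ : H) :
    ∀ᵐ q ∂(μ₁ ⊗ₘ β),
      ‖v ψ q.2‖ ^ 2 * M₁.dens μ₁ φ q.1 = ‖v φ q.2‖ ^ 2 * M₁.dens μ₁ ψ q.1 := by
  filter_upwards [ae_all_iff.2 fun K =>
    h.norm_sq_mul_dens_comm_of_bounded hμ₁ hv hadd hsmul hvM φ ψ K] with q hq
  obtain ⟨K, hK⟩ := exists_nat_ge (max ‖v φ q.2‖ ‖v ψ q.2‖)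
  exact hq K ((le_max_left _ _).trans hK) ((le_max_right _ _).trans hK)

theorem IsPostProcessing.exists_formDens_eq (h : M₁.IsPostProcessing β M₂)
    {μ₁ : Measure Ω₁} [SigmaFinite μ₁] (hμ₁ : M₁.AbsCont μ₁) {u : ℕ → H}
    (hu : μ₁ ≪ Measure.sum fun n => M₁.outcome (u n)) {μ₂ : Measure Ω₂} (hμ₂ : M₂.AbsCont μ₂)
    {v : H → Ω₂ → ℂ} (hv : ∀ φ, Measurable (v φ))
    (hadd : ∀ φ ψ, v (φ + ψ) =ᵐ[μ₂] fun y => v φ y + v ψ y)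
    (hsmul : ∀ (c : ℂ) φ, v (c • φ) =ᵐ[μ₂] fun y => c * v φ y)
    (hvM : ∀ φ, M₂.outcome φ = μ₂.withDensity fun y => ENNReal.ofReal (‖v φ y‖ ^ 2)) :
    ∃ c : Ω₁ × Ω₂ → ℝ, ∀ φ ψ, ∀ᵐ q ∂(μ₁ ⊗ₘ β),
      M₁.formDens μ₁ φ ψ q.1 = c q * (star (v φ q.2) * v ψ q.2) := by
  have hne : ∀ᵐ q ∂(μ₁ ⊗ₘ β), ∃ n, v (u n) q.2 ≠ 0 := by
    refine h.ae_compProd_snd (p := fun y => ∃ n, v (u n) y ≠ 0) hu fun n => ?_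
    rw [hvM, ae_withDensity_iff (by have := hv (u n); fun_prop)]
    refine Filter.Eventually.of_forall fun y hy => ⟨n, fun h0 => hy ?_⟩
    simp [h0]
  -- The factor is chosen pointwise, with no measurability: it is only needed for algebra at each
  -- point.
  have hc : ∀ q : Ω₁ × Ω₂, ∃ c : ℝ, (∃ n, v (u n) q.2 ≠ 0) →
      ∃ n, v (u n) q.2 ≠ 0 ∧ c = M₁.dens μ₁ (u n) q.1 / ‖v (u n) q.2‖ ^ 2 := fun q => by
    by_cases hq : ∃ n, v (u n) q.2 ≠ 0
    · obtain ⟨n, hn⟩ := hq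
      exact ⟨_, fun _ => ⟨n, hn, rfl⟩⟩
    · exact ⟨0, fun h1 => absurd h1 hq⟩
  choose c hc using hc
  refine ⟨c, fun φ ψ => ?_⟩
  have hdens : ∀ ξ, ∀ᵐ q ∂(μ₁ ⊗ₘ β), M₁.dens μ₁ ξ q.1 = c q * ‖v ξ q.2‖ ^ 2 := fun ξ => by
    filter_upwards [hne, ae_all_iff.2 fun n =>
      h.norm_sq_mul_dens_comm hμ₁ hv hadd hsmul hvM ξ (u n)] with q h1 h2
    obtain ⟨n, hn, hcn⟩ := hc q h1
    have hpos : ‖v (u n) q.2‖ ^ 2 ≠ 0 := by simpa using hn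
    rw [hcn, div_mul_eq_mul_div, eq_div_iff hpos, mul_comm, h2 n, mul_comm]
  have hlift : ∀ {p : Ω₂ → Prop}, (∀ᵐ y ∂μ₂, p y) → ∀ᵐ q ∂(μ₁ ⊗ₘ β), p q.2 := fun hp =>
    h.ae_compProd_snd hu fun n => (hμ₂.outcome (u n)).ae_le hp
  filter_upwards [hdens φ, hdens ψ, hdens (φ + ψ), hdens (φ + Complex.I • ψ), hlift (hadd φ ψ),
    hlift (hadd φ (Complex.I • ψ)), hlift (hsmul Complex.I ψ)] with q h1 h2 h3 h4 h5 h6 h7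
  rw [formDens, h1, h2, h3, h4, h5, h6, h7]
  simp only [← Complex.normSq_eq_norm_sq]
  apply Complex.ext
  · simp only [Complex.normSq_apply, RCLike.star_def, Complex.add_re,
        Complex.mul_re, Complex.mul_im, Complex.add_im, Complex.conj_re, Complex.conj_im,
        Complex.ofReal_re, Complex.ofReal_im]
    ring
  · simp only [Complex.normSq_apply, RCLike.star_def, Complex.add_re,
        Complex.mul_re, Complex.mul_im, Complex.add_im, Complex.conj_re, Complex.conj_im,
        Complex.ofReal_re, Complex.ofReal_im, Complex.I_re, Complex.I_im]
    ring

end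

end POVM
end

theorem mainTheorem2 {Ω₁ Ω₂ H : Type*} [MeasurableSpace Ω₁] [MeasurableSpace Ω₂]
    [NormedAddCommGroup H] [InnerProductSpace ℂ H] [CompleteSpace H]
    [TopologicalSpace.SeparableSpace H]
    (M₁ : POVM Ω₁ H) (β : ProbabilityTheory.Kernel Ω₁ Ω₂) [ProbabilityTheory.IsMarkovKernel β]
    (M₂ : POVM Ω₂ H) (hM₂ : M₁.IsPostProcessing β M₂) (hrank : M₂.IsRankOne) :
    M₁.IsRankOne := by
  let u : ℕ → H := TopologicalSpace.denseSeq H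
  let μ₁ : Measure Ω₁ := (Measure.sum fun n => M₁.outcome (u n)).toFinite
  have hu : μ₁ ≪ Measure.sum fun n => M₁.outcome (u n) := toFinite_absolutelyContinuous _
  -- A null set of `μ₁` is null for the outcome measures of a dense sequence, which forces its
  -- operator to vanish.
  have hμ₁ : M₁.AbsCont μ₁ := fun X hX h0 => by
    refine M₁.op_eq_zero_of_outcome (TopologicalSpace.denseRange_denseSeq H) hX fun n => ?_
    have h1 := absolutelyContinuous_toFinite (Measure.sum fun n => M₁.outcome (u n)) h0
    rw [Measure.sum_apply _ hX, ENNReal.tsum_eq_zero] at h1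
    exact h1 n
  obtain ⟨μ₂, v, -, hμ₂, hv, hadd, hsmul, hvM⟩ := hrank.exists_density_vector
  obtain ⟨c, hc⟩ := hM₂.exists_formDens_eq hμ₁ hu hμ₂ hv hadd hsmul hvM
  refine M₁.isRankOne_of_formDens_mul μ₁ hμ₁ hu fun φ ψ χ => ?_
  have hae : ∀ᵐ q ∂(μ₁ ⊗ₘ β), M₁.formDens μ₁ φ χ q.1 * M₁.formDens μ₁ χ ψ q.1 =
      M₁.formDens μ₁ χ χ q.1 * M₁.formDens μ₁ φ ψ q.1 := by
    filter_upwards [hc φ χ, hc χ ψ, hc χ χ, hc φ ψ] with q h1 h2 h3 h4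
    rw [h1, h2, h3, h4]
    ring
  filter_upwards [Measure.ae_ae_of_ae_compProd hae] with x hx
  -- The relation does not involve y, and `β x` is a probability measure, so holding for almost
  -- every y means holding.
  exact Filter.eventually_const.1 hx
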